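/- Let $n\ge 2$, with all matrix subscripts read modulo $n$. Let $E_{ij}\in M_n(\mathbb{Z})$ be the matrix units and put $X=E_{21}+E_{32}+\dots+E_{n,n-1}+E_{1n}$, $Y=E_{11}$. For elements $x,y$ of a ring let $$r_{1,n}(x)=x^n-1,\quad r_{2,n}(x,y)=\sum_{i=0}^{n-1}x^{n-i}yx^i-1,\quad s_0(y)=y^2-y,\quad s_j(x,y)=yx^jy\ (j\ge 1).$$ For integers $x_1,\dots,x_n$ let $\mathrm{circ}(x_1,\dots,x_n)=\sum_{i=1}^n x_{n-i+1}X^i$; the integral circulant matrices are the matrices of this form. Let $$\mathcal{Y}=\{Y_1\in M_n(\mathbb{Z})\mid Y_1^2=Y_1,\ r_{2,n}(X,Y_1)=0\}.$$ Then: 1. For every $Y_1\in\mathcal{Y}$ the pair $(X,Y_1)$ satisfies all the relations $r_{1,n}=r_{2,n}=s_0=s_k=0$, $1\le k\le\lfloor n/2\rfloor$, and $Y_1$ has trace $1$. 2. If $n\in\{2,3,4,6\}$, then $\mathcal{Y}=\{E_{ii}\mid 1\le i\le n\}$. 3. If $n\notin\{2,3,4,6\}$, then $\mathcal{Y}$ is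 infinite, and every $Y_1\in\mathcal{Y}$ that is not one of the matrices $E_{ii}$ has both positive and negative entries. 4. For every $Y_1\in\mathcal{Y}$ there are integers $c_1,\dots,c_n,d_1,\dots,d_n$ such that $Y_1=(c_id_j)$ and the matrices $\mathrm{circ}(c_1,\dots,c_n)$ and $\mathrm{circ}(d_1,\dots,d_n)^{T}$ are mutually inverse. 5. For every $Y_1\in\mathcal{Y}$ there is an integral circulant matrix $C$ with $\det C=\pm1$ and $Y_1=CYC^{-1}$. -/

import Mathlib

namespace MatrixPresentation

/-- The noncommutative polynomial `r_{1,n}(x) = x^n - 1`, evaluated in a ring. -/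
def r₁ {R : Type*} [Ring R] (n : ℕ) (x : R) : R := x ^ n - 1

/-- The noncommutative polynomial `r_{2,n}(x,y) = ∑_{i=0}^{n-1} x^{n-i} y x^i - 1`,
evaluated in a ring. -/
def r₂ {R : Type*} [Ring R] (n : ℕ) (x y : R) : R :=
  (∑ i ∈ Finset.range n, x ^ (n - i) * y * x ^ i) - 1

/-- The noncommutative polynomial `s_0(y) = y^2 - y`, evaluated in a ring. -/
def s₀ {R : Type*} [Ring R] (y : R) : R := y ^ 2 - y

/-- The noncommutative polynomial `s_j(x,y) = y x^j y` (used for `j ≥ 1`),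
evaluated in a ring. -/
def s {R : Type*} [Ring R] (j : ℕ) (x y : R) : R := y * x ^ j * y

/-- The pair `(x, y)` satisfies all relations of the presentation
`⟨x, y | r_{1,n} = r_{2,n} = s_0 = s_k = 0, 1 ≤ k ≤ ⌊n/2⌋⟩`. -/
def SatisfiesShortPresentation {R : Type*} [Ring R] (n : ℕ) (x y : R) : Prop :=
  r₁ n x = 0 ∧ r₂ n x y = 0 ∧ s₀ y = 0 ∧ ∀ k : ℕ, 1 ≤ k → k ≤ n / 2 → s k x y = 0

/-- The cyclic permutation matrix `X = E_{21} + E_{32} + ⋯ + E_{n,n-1} + E_{1n}`.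
Indices live in `Fin n` (so they start at `0`), where addition is modulo `n`. -/
def X (n : ℕ) [NeZero n] : Matrix (Fin n) (Fin n) ℤ :=
  ∑ i : Fin n, Matrix.single (i + 1) i 1

/-- The matrix `Y = E_{11}` (the index `1` is `0 : Fin n`). -/
def Y (n : ℕ) [NeZero n] : Matrix (Fin n) (Fin n) ℤ := Matrix.single 0 0 1

/-- The set `𝒴` of integral idempotents `Y₁` with `r_{2,n}(X, Y₁) = 0`. -/
def idempotentSet (n : ℕ) [NeZero n] : Set (Matrix (Fin n) (Fin n) ℤ) :=
  {Y₁ | Y₁ ^ 2 = Y₁ ∧ r₂ n (X n) Y₁ = 0}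

/-- The circulant matrix `circ (x_1, …, x_n) = ∑_{i=1}^n x_{n-i+1} X^i`. With `x_j` stored at
position `j - 1` of `Fin n`, the coefficient `x_{n-i+1}` is at position `j = n - i`, and
`i = n - j`. The first row of the matrix is `x_1, …, x_n`. -/
def circ {n : ℕ} [NeZero n] (x : Fin n → ℤ) : Matrix (Fin n) (Fin n) ℤ :=
  ∑ j : Fin n, x j • X n ^ (n - (j : ℕ))

end MatrixPresentation

/-!
Conjugation by powers of the cyclic permutation matrix `X` shifts both indices of a matrix, so
`r₂ n X M = 0` says that the entries of `M` along each cyclic diagonal sum to `0`, except for the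
main diagonal, along which they sum to `1` (`r₂_eq_zero_iff`). In particular `M` has trace `1`. If
`M` is also idempotent, its range is a free `ℤ`-module whose rank is the trace, so `M = c dᵀ` for
integral vectors `c`, `d`, and the diagonal sums become the relations
`∑ t, c (a + t) * d (b + t) = δ_{ab}` (`exists_factorization`). These say that `circ c` and
`(circ d)ᵀ` are mutually inverse, and the relations `Y₁ X^k Y₁ = 0`, the factorization of `M` and
its conjugacy to `E₁₁` are read off from them. The statement on signs only needs the diagonal sums
(`eq_single_of_nonneg`).

For `n ∈ {2, 3, 4, 6}` every `n`-th root of unity has degree at most `2` over `ℚ`. At each of them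
`c` takes a value which is a unit of `ℤ` or of an imaginary quadratic ring, hence of absolute value
`1`. By Parseval `∑ t, c t ^ 2 = 1`, and the same holds for `d` (`sum_sq_eq_one`). Since also
`∑ t, c t * d t = 1`, this forces `c = d = ± e_i` and `M = E_{ii}`.

For other `n` there is `a` coprime to `n` with `2 ≤ a ≤ n - 2`. If `a b = n m + 1`, then
`u = (1 + ⋯ + x^(a-1)) (1 + ⋯ + x^(b-1)) - m (1 + ⋯ + x^(n-1))` is a unit of `ℤ[x] / (x ^ n - 1)`
(`aeval_unitPoly_mul`), with an inverse taking the value `1` at `1`. At `ζ = exp (2πi/n)` its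
absolute value is `sin (πa/n) sin (πb/n) / sin (π/n) ^ 2 > 1` (`one_lt_norm_aeval_unitPoly`). The
conjugates of `E₁₁` by the powers `u(X)^k` are distinct members of the set, because
`∑ i j, ζ^i M_{ij}` equals `u(ζ)^k` on the `k`-th of them (`idempotentSet_infinite`).
-/

open Matrix

namespace MatrixPresentation

/-! ### Entries of powers of the cyclic matrix and of circulants -/

theorem X_apply {n : ℕ} [NeZero n] (a b : Fin n) :
    X n a b = if a = b + 1 then 1 else 0 := by
  simp only [X, Matrix.sum_apply, Matrix.single_apply]
  rw [Finset.sum_eq_single b]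
  · simp [eq_comm]
  · intro i _ hi; simp [hi]
  · simp

open Fin.CommRing in
theorem X_pow_apply {n : ℕ} [NeZero n] (k : ℕ) (a b : Fin n) :
    (X n ^ k) a b = if a = b + (k : Fin n) then 1 else 0 := by
  induction k generalizing b with
  | zero => simp [Matrix.one_apply]
  | succ k ih =>
    rw [pow_succ, Matrix.mul_apply]
    simp only [X_apply, mul_ite, mul_one, mul_zero, Finset.sum_ite_eq', Finset.mem_univ, if_true,
      ih]
    simp [add_comm, add_left_comm]

theorem X_pow_val_apply {n : ℕ} [NeZero n] (t a b : Fin n) :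
    (X n ^ (t : ℕ)) a b = if a = b + t then 1 else 0 := by
  rw [X_pow_apply]; simp

theorem X_pow_sub_val_apply {n : ℕ} [NeZero n] (t a b : Fin n) :
    (X n ^ (n - (t : ℕ))) a b = if b = a + t then 1 else 0 := by
  open Fin.CommRing in
  rw [X_pow_apply, Nat.cast_sub t.isLt.le]
  simp only [Fin.natCast_self, Fin.cast_val_eq_self, zero_sub]
  congr 1
  rw [eq_iff_iff, ← sub_eq_add_neg, eq_sub_iff_add_eq, eq_comm]

theorem X_pow_card (n : ℕ) [NeZero n] : X n ^ n = 1 := by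
  ext a b
  rw [X_pow_apply]
  simp [Matrix.one_apply]

theorem circ_apply {n : ℕ} [NeZero n] (x : Fin n → ℤ) (a b : Fin n) :
    circ x a b = x (b - a) := by
  simp only [circ, Matrix.sum_apply, Matrix.smul_apply, X_pow_sub_val_apply]
  rw [Finset.sum_eq_single (b - a)]
  · simp
  · intro t _ ht
    rw [if_neg, smul_zero]
    rintro rfl
    simp at ht
  · simp

/-! ### The relation `r₂ = 0` and the rank-one factorization -/

theorem conj_sum_apply {n : ℕ} [NeZero n] (M : Matrix (Fin n) (Fin n) ℤ) (a b : Fin n) :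
    (∑ i ∈ Finset.range n, X n ^ (n - i) * M * X n ^ i) a b = ∑ t, M (a + t) (b + t) := by
  rw [Finset.sum_range, Matrix.sum_apply]
  refine Finset.sum_congr rfl fun t _ => ?_
  simp only [Matrix.mul_apply, X_pow_val_apply, X_pow_sub_val_apply]
  simp

theorem r₂_eq_zero_iff {n : ℕ} [NeZero n] (M : Matrix (Fin n) (Fin n) ℤ) :
    r₂ n (X n) M = 0 ↔ ∀ a b, ∑ t, M (a + t) (b + t) = if a = b then 1 else 0 := by
  rw [r₂, sub_eq_zero, ← Matrix.ext_iff]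
  simp only [conj_sum_apply, Matrix.one_apply]

theorem trace_eq_one {n : ℕ} [NeZero n] {M : Matrix (Fin n) (Fin n) ℤ}
    (h : ∀ a b, ∑ t, M (a + t) (b + t) = if a = b then 1 else 0) : M.trace = 1 := by
  simpa [Matrix.trace] using h 0 0

/-- The trace of an idempotent is the rank of its range. Over `ℤ` the range is free, so trace `1`
means that it is spanned by a single vector `c`, and every column is a multiple of `c`. -/
theorem exists_eq_vecMulVec {n : ℕ} {M : Matrix (Fin n) (Fin n) ℤ} (h : M ^ 2 = M)
    (ht : M.trace = 1) : ∃ c d : Fin n → ℤ, ∀ i j, M i j = c i * d j := by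
  have hid : IsIdempotentElem M.toLin' := by
    rw [IsIdempotentElem, Module.End.mul_eq_comp, ← Matrix.toLin'_mul, ← sq, h]
  have hp := LinearMap.IsIdempotentElem.isProj_range M.toLin' hid
  have htr := hp.trace
  rw [Matrix.trace_toLin'_eq, ht] at htr
  have hf : Module.finrank ℤ (LinearMap.range M.toLin') = 1 := by exact_mod_cast htr.symm
  obtain ⟨v, -, hv⟩ := finrank_eq_one_iff'.1 hf
  choose d hd using fun j => hv ⟨M.toLin' (Pi.single j 1), LinearMap.mem_range_self _ _⟩
  refine ⟨v.1, d, fun i j => ?_⟩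
  have := congrFun (congrArg Subtype.val (hd j)) i
  simp only [Submodule.coe_smul, Pi.smul_apply, smul_eq_mul, Matrix.toLin'_apply,
    Matrix.mulVec_single_one, Matrix.col_apply] at this
  rw [← this, mul_comm]

theorem exists_factorization {n : ℕ} [NeZero n] {M : Matrix (Fin n) (Fin n) ℤ}
    (hM : M ∈ idempotentSet n) : ∃ c d : Fin n → ℤ, (∀ i j, M i j = c i * d j) ∧
      ∀ a b, ∑ t, c (a + t) * d (b + t) = if a = b then 1 else 0 := by
  have h := (r₂_eq_zero_iff M).1 hM.2
  obtain ⟨c, d, hcd⟩ := exists_eq_vecMulVec hM.1 (trace_eq_one h)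
  exact ⟨c, d, hcd, fun a b => by simpa only [hcd] using h a b⟩

theorem satisfiesShortPresentation {n : ℕ} [NeZero n] {M : Matrix (Fin n) (Fin n) ℤ}
    (hM : M ∈ idempotentSet n) : SatisfiesShortPresentation n (X n) M := by
  refine ⟨by rw [r₁, X_pow_card, sub_self], hM.2, by rw [s₀, hM.1, sub_self], fun k hk hk' => ?_⟩
  obtain ⟨c, d, hcd, h⟩ := exists_factorization hM
  have hkn : k < n := by omega
  have hk0 : (⟨k, hkn⟩ : Fin n) ≠ 0 := by
    intro h0
    have := congrArg Fin.val h0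
    simp at this
    omega
  have hz := h 0 ⟨k, hkn⟩
  rw [if_neg hk0.symm] at hz
  ext a b
  have e := fun p q => X_pow_val_apply (⟨k, hkn⟩ : Fin n) p q
  simp only at e
  simp only [s, Matrix.mul_apply, e, hcd, mul_ite, mul_one, mul_zero, Finset.sum_ite_eq',
    Finset.mem_univ, if_true, Matrix.zero_apply]
  have : ∀ q, c a * d (q + ⟨k, hkn⟩) * (c q * d b) =
      c a * d b * (c (0 + q) * d (⟨k, hkn⟩ + q)) := by
    intro q; rw [zero_add, add_comm]; ring
  simp only [this, ← Finset.mul_sum, hz, mul_zero]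

/-! ### Sign of the entries -/

theorem exists_eq_one_of_sum_eq_one {ι : Type*} [Fintype ι] [DecidableEq ι] {f : ι → ℤ}
    (h0 : ∀ i, 0 ≤ f i) (h1 : ∑ i, f i = 1) : ∃ i, f i = 1 ∧ ∀ j, j ≠ i → f j = 0 := by
  have hex : ∃ i, f i ≠ 0 := by
    by_contra! hc
    simp [hc] at h1
  obtain ⟨i, hi⟩ := hex
  have hsplit := Finset.add_sum_erase Finset.univ f (Finset.mem_univ i)
  have hrest : 0 ≤ ∑ t ∈ Finset.univ.erase i, f t := Finset.sum_nonneg fun t _ => h0 t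
  have hi' := h0 i
  have hr0 : ∑ t ∈ Finset.univ.erase i, f t = 0 := by omega
  rw [Finset.sum_eq_zero_iff_of_nonneg fun t _ => h0 t] at hr0
  exact ⟨i, by omega, fun j hj => hr0 j (by simpa using hj)⟩

/-- The sum of the entries of `M` along each cyclic off-diagonal is `0`, so a nonnegative `M` is
diagonal, and its diagonal entries sum to `1`. -/
theorem eq_single_of_nonneg {n : ℕ} [NeZero n] {M : Matrix (Fin n) (Fin n) ℤ}
    (h : ∀ a b, ∑ t, M (a + t) (b + t) = if a = b then 1 else 0) (h0 : ∀ i j, 0 ≤ M i j) :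
    ∃ i, M = Matrix.single i i 1 := by
  have hoff : ∀ a b, a ≠ b → M a b = 0 := by
    intro a b hab
    have := h a b
    rw [if_neg hab, Finset.sum_eq_zero_iff_of_nonneg fun t _ => h0 _ _] at this
    simpa using this 0 (Finset.mem_univ _)
  have h1 := h 0 0
  simp only [zero_add, if_true] at h1
  obtain ⟨i, hi, hr0⟩ := exists_eq_one_of_sum_eq_one (fun t => h0 t t) h1
  refine ⟨i, ?_⟩
  ext a b
  rw [Matrix.single_apply]
  split_ifs with hc
  · obtain ⟨rfl, rfl⟩ := hc; exact hi
  · by_cases hab : a = b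
    · subst hab
      exact hr0 a fun e => hc ⟨e.symm, e.symm⟩
    · exact hoff a b hab

theorem single_mem {n : ℕ} [NeZero n] (i : Fin n) :
    Matrix.single i i (1 : ℤ) ∈ idempotentSet n := by
  refine ⟨by rw [sq, Matrix.single_mul_single_same, one_mul], (r₂_eq_zero_iff _).2 fun a b => ?_⟩
  rw [Finset.sum_eq_single (i - a)]
  · have : i = b + (i - a) ↔ a = b := by
      rw [← add_sub_assoc, eq_sub_iff_add_eq, add_comm b, add_right_inj]
    simp [Matrix.single_apply, this]
  · intro t _ ht
    rw [Matrix.single_apply, if_neg]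
    rintro ⟨e, -⟩
    exact ht (by rw [e]; simp)
  · simp

/-! ### The orders `2`, `3`, `4` and `6` -/

/-- Let `ζ` satisfy `ζ ^ 2 = p ζ - 1`, with conjugate `ζ⁻¹ = p - ζ`. The hypotheses say that
`(A + B ζ) (A' + B' ζ⁻¹) = 1`, and the conclusion that `A + B ζ` has norm `1`. The condition on `p`
makes the norm form nonnegative, which excludes the value `-1`. -/
theorem normForm_eq_one {p A B A' B' : ℤ} (hp : p ^ 2 ≤ 4)
    (h₁ : A * A' + B * B' + p * (A * B') = 1) (h₂ : B * A' - A * B' = 0) :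
    A ^ 2 + p * (A * B) + B ^ 2 = 1 := by
  have hmul : (A ^ 2 + p * (A * B) + B ^ 2) * (A' ^ 2 + p * (A' * B') + B' ^ 2) = 1 := by
    linear_combination (A * A' + B * B' + p * (A * B') + 1) * h₁ +
      (p * (A * A' + B * B' + p * (A * B')) + (B * A' - A * B')) * h₂
  have hnn : 0 ≤ A ^ 2 + p * (A * B) + B ^ 2 := by
    nlinarith [sq_nonneg (2 * A + p * B), mul_nonneg (sub_nonneg.2 hp) (sq_nonneg B)]
  rcases Int.eq_one_or_neg_one_of_mul_eq_one hmul with h | h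
  · exact h
  · omega

/-- Parseval for the group ring of a cyclic group of order `2`, `3`, `4` or `6`: the sum of squares
is the average of the squared absolute values at the `n`-th roots of unity. Each of these is `1` by
`normForm_eq_one`, used with `p = 0, -1, 1` for roots of unity of order `4`, `3`, `6`, and with
`B = B' = 0` for `1` and `-1`. -/
theorem sum_sq_eq_one {n : ℕ} [NeZero n] (hn : n = 2 ∨ n = 3 ∨ n = 4 ∨ n = 6) {c d : Fin n → ℤ}
    (h : ∀ a b, ∑ t, c (a + t) * d (b + t) = if a = b then 1 else 0) : ∑ t, c t ^ 2 = 1 := by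
  have e := h 0
  rcases hn with rfl | rfl | rfl | rfl
  · have e0 := e 0
    have e1 := e 1
    simp [Fin.sum_univ_two] at e0 e1 ⊢
    have f1 := normForm_eq_one (p := 0) (A := c 0 + c 1) (B := 0) (A' := d 0 + d 1) (B' := 0)
      (by norm_num) (by linear_combination e0 + e1) (by ring)
    have f2 := normForm_eq_one (p := 0) (A := c 0 - c 1) (B := 0) (A' := d 0 - d 1) (B' := 0)
      (by norm_num) (by linear_combination e0 - e1) (by ring)
    linarith
  · have e0 := e 0
    have e1 := e 1
    have e2 := e 2
    simp [Fin.sum_univ_three] at e0 e1 e2 ⊢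
    have f1 := normForm_eq_one (p := 0) (A := c 0 + c 1 + c 2) (B := 0)
      (A' := d 0 + d 1 + d 2) (B' := 0)
      (by norm_num) (by linear_combination e0 + e1 + e2) (by ring)
    have f3 := normForm_eq_one (p := -1) (A := c 0 - c 2) (B := c 1 - c 2)
      (A' := d 0 - d 2) (B' := d 1 - d 2)
      (by norm_num) (by linear_combination e0 - e1) (by linear_combination e2 - e1)
    linarith
  · have e0 := e 0
    have e1 := e 1
    have e2 := e 2
    have e3 := e 3
    simp [Fin.sum_univ_four] at e0 e1 e2 e3 ⊢
    have f1 := normForm_eq_one (p := 0) (A := c 0 + c 1 + c 2 + c 3) (B := 0)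
      (A' := d 0 + d 1 + d 2 + d 3) (B' := 0)
      (by norm_num) (by linear_combination e0 + e1 + e2 + e3) (by ring)
    have f2 := normForm_eq_one (p := 0) (A := c 0 - c 1 + c 2 - c 3) (B := 0)
      (A' := d 0 - d 1 + d 2 - d 3) (B' := 0)
      (by norm_num) (by linear_combination e0 - e1 + e2 - e3) (by ring)
    have f4 := normForm_eq_one (p := 0) (A := c 0 - c 2) (B := c 1 - c 3)
      (A' := d 0 - d 2) (B' := d 1 - d 3)
      (by norm_num) (by linear_combination e0 - e2) (by linear_combination e3 - e1)
    linarith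
  · have e0 := e 0
    have e1 := e 1
    have e2 := e 2
    have e3 := e 3
    have e4 := e 4
    have e5 := e 5
    simp [Fin.sum_univ_six] at e0 e1 e2 e3 e4 e5 ⊢
    have f1 := normForm_eq_one (p := 0) (A := c 0 + c 1 + c 2 + c 3 + c 4 + c 5) (B := 0)
      (A' := d 0 + d 1 + d 2 + d 3 + d 4 + d 5) (B' := 0)
      (by norm_num) (by linear_combination e0 + e1 + e2 + e3 + e4 + e5) (by ring)
    have f2 := normForm_eq_one (p := 0) (A := c 0 - c 1 + c 2 - c 3 + c 4 - c 5) (B := 0)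
      (A' := d 0 - d 1 + d 2 - d 3 + d 4 - d 5) (B' := 0)
      (by norm_num) (by linear_combination e0 - e1 + e2 - e3 + e4 - e5) (by ring)
    have f3 := normForm_eq_one (p := -1) (A := c 0 - c 2 + c 3 - c 5) (B := c 1 - c 2 + c 4 - c 5)
      (A' := d 0 - d 2 + d 3 - d 5) (B' := d 1 - d 2 + d 4 - d 5)
      (by norm_num) (by linear_combination e0 - e1 + e3 - e4)
      (by linear_combination e2 - e1 + e5 - e4)
    have f6 := normForm_eq_one (p := 1) (A := c 0 - c 2 - c 3 + c 5) (B := c 1 + c 2 - c 4 - c 5)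
      (A' := d 0 - d 2 - d 3 + d 5) (B' := d 1 + d 2 - d 4 - d 5)
      (by norm_num) (by linear_combination e0 + e1 - e3 - e4)
      (by linear_combination e4 + e5 - e1 - e2)
    linarith

theorem exists_eq_single {n : ℕ} [NeZero n] (hn : n = 2 ∨ n = 3 ∨ n = 4 ∨ n = 6)
    {M : Matrix (Fin n) (Fin n) ℤ} (hM : M ∈ idempotentSet n) :
    ∃ i, M = Matrix.single i i 1 := by
  obtain ⟨c, d, hcd, h⟩ := exists_factorization hM
  have hc := sum_sq_eq_one hn h
  have hd := sum_sq_eq_one (c := d) (d := c) hn fun a b => by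
    simpa only [mul_comm, eq_comm] using h b a
  have hcd1 := h 0 0
  simp only [zero_add, if_true] at hcd1
  -- Equality in the Cauchy-Schwarz inequality gives `c = d`.
  have hsub : ∑ t, (c t - d t) ^ 2 = 0 := by
    have : ∀ t, (c t - d t) ^ 2 = c t ^ 2 + d t ^ 2 - 2 * (c t * d t) := fun t => by ring
    simp only [this, Finset.sum_sub_distrib, Finset.sum_add_distrib, ← Finset.mul_sum, hc, hd, hcd1]
    norm_num
  rw [Finset.sum_eq_zero_iff_of_nonneg fun t _ => sq_nonneg _] at hsub
  have hdc : ∀ t, d t = c t := fun t =>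
    (sub_eq_zero.1 (pow_eq_zero_iff two_ne_zero |>.1 (hsub t (Finset.mem_univ t)))).symm
  obtain ⟨i, hi, hr0⟩ := exists_eq_one_of_sum_eq_one (fun t => sq_nonneg (c t)) hc
  have hz : ∀ t, i ≠ t → c t = 0 := fun t ht => pow_eq_zero_iff two_ne_zero |>.1 (hr0 t ht.symm)
  have hone : c i * c i = 1 := by rw [← sq, hi]
  refine ⟨i, ?_⟩
  ext a b
  rw [Matrix.single_apply, hcd, hdc]
  by_cases ha : i = a
  · by_cases hb : i = b
    · subst ha; subst hb; simpa using hone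
    · simp [hz b hb, hb]
  · simp [hz a ha, ha]

/-! ### A unit of infinite order in the group ring of a cyclic group -/

theorem geom_sum_mul_index {R : Type*} [CommRing R] (x : R) (a b : ℕ) :
    (∑ i ∈ Finset.range a, x ^ i) * ∑ j ∈ Finset.range b, (x ^ a) ^ j =
      ∑ i ∈ Finset.range (a * b), x ^ i := by
  induction b with
  | zero => simp
  | succ b ih =>
    rw [Finset.sum_range_succ, mul_add, ih, Nat.mul_succ, Finset.sum_range_add, Finset.sum_mul]
    simp only [pow_add, pow_mul, mul_comm]

/-- With `N = 1 + x + ⋯ + x^(n-1)`, the products of the geometric sums in `x` and in `x ^ a`, and of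
those in `x` and in `x ^ b`, are both `1 + m N`. Since `x N = N`, every polynomial in `x` acts on
`N` through its value at `1`, and the terms `m N` are chosen to bring the value `a b` at `1` down
to `1`. -/
theorem geom_sum_unit_mul_eq_one {R : Type*} [CommRing R] {n a b m : ℕ} (h : a * b = n * m + 1)
    {x : R} (hx : x ^ n = 1) :
    ((∑ i ∈ Finset.range a, x ^ i) * (∑ i ∈ Finset.range b, x ^ i) -
        m * ∑ i ∈ Finset.range n, x ^ i) *
      ((∑ i ∈ Finset.range b, (x ^ a) ^ i) * (∑ i ∈ Finset.range a, (x ^ b) ^ i) -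
        m * ∑ i ∈ Finset.range n, x ^ i) = 1 := by
  have hxN : x * ∑ i ∈ Finset.range n, x ^ i = ∑ i ∈ Finset.range n, x ^ i := by
    have := mul_geom_sum x n
    rw [hx] at this
    linear_combination this
  have hab := geom_sum_mul_index x a b
  have hba := geom_sum_mul_index x b a
  have hnm := geom_sum_mul_index x n m
  rw [mul_comm b a] at hba
  rw [h, Finset.sum_range_succ, pow_mul, hx, one_pow] at hab hba
  simp only [hx, one_pow, Finset.sum_const, Finset.card_range, nsmul_eq_mul, mul_one] at hnm
  rw [← hnm] at hab hba
  set N := ∑ i ∈ Finset.range n, x ^ i with hN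
  have hpow : ∀ k : ℕ, x ^ k * N = N := by
    intro k
    induction k with
    | zero => simp
    | succ k ih => rw [pow_succ, mul_assoc, hxN, ih]
  have hS : ∀ k l : ℕ, (∑ i ∈ Finset.range k, (x ^ l) ^ i) * N = k * N := by
    intro k l
    simp only [← pow_mul, Finset.sum_mul, hpow, Finset.sum_const, Finset.card_range, nsmul_eq_mul]
  have hSa := hS a 1
  have hSb := hS b 1
  have hSn := hS n 1
  simp only [pow_one] at hSa hSb hSn
  rw [← hN] at hSn
  have hSa' := hS a b
  have hSb' := hS b a
  have hR : (a : R) * b = n * m + 1 := by exact_mod_cast congrArg (Nat.cast (R := R)) h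
  generalize (∑ i ∈ Finset.range a, x ^ i) = p at *
  generalize (∑ i ∈ Finset.range b, x ^ i) = q at *
  generalize (∑ i ∈ Finset.range b, (x ^ a) ^ i) = q' at *
  generalize (∑ i ∈ Finset.range a, (x ^ b) ^ i) = p' at *
  have e1 : p * q * N = (n * m + 1) * N := by
    linear_combination p * hSb + b * hSa + N * hR
  have e2 : q' * p' * N = (n * m + 1) * N := by
    linear_combination q' * hSa' + a * hSb' + N * hR
  linear_combination q * p' * hab + (N * m + 1) * hba - m * e1 - m * e2 + 2 * m ^ 2 * hSn

open Polynomial in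
/-- The polynomial `(1 + ⋯ + x^(a-1)) (1 + ⋯ + x^(b-1)) - m (1 + ⋯ + x^(n-1))`. It represents a unit
modulo `x ^ n - 1` when `a b = n m + 1`. -/
noncomputable def unitPoly (n a b m : ℕ) : ℤ[X] :=
  (∑ i ∈ Finset.range a, Polynomial.X ^ i) * (∑ i ∈ Finset.range b, Polynomial.X ^ i) -
    (m : ℤ[X]) * ∑ i ∈ Finset.range n, Polynomial.X ^ i

open Polynomial in
/-- An inverse of `unitPoly n a b m` modulo `x ^ n - 1` when `a b = n m + 1`. -/
noncomputable def unitPolyInv (n a b m : ℕ) : ℤ[X] :=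
  (∑ i ∈ Finset.range b, (Polynomial.X ^ a) ^ i) * (∑ i ∈ Finset.range a, (Polynomial.X ^ b) ^ i) -
    (m : ℤ[X]) * ∑ i ∈ Finset.range n, Polynomial.X ^ i

/-- The ring `R` may be noncommutative, as the identity is obtained from the divisibility of
`unitPoly * unitPolyInv - 1` by `x ^ n - 1` in `ℤ[x]`. -/
theorem aeval_unitPoly_mul {R : Type*} [Ring R] {n a b m : ℕ} (h : a * b = n * m + 1)
    {x : R} (hx : x ^ n = 1) :
    Polynomial.aeval x (unitPoly n a b m) * Polynomial.aeval x (unitPolyInv n a b m) = 1 := by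
  have hdvd : (Polynomial.X ^ n - 1 : Polynomial ℤ) ∣
      unitPoly n a b m * unitPolyInv n a b m - 1 := by
    rw [← AdjoinRoot.mk_eq_zero, map_sub, map_mul, map_one, sub_eq_zero]
    have hr : AdjoinRoot.root (Polynomial.X ^ n - 1 : Polynomial ℤ) ^ n = 1 := by
      have := AdjoinRoot.mk_self (f := (Polynomial.X ^ n - 1 : Polynomial ℤ))
      rwa [map_sub, map_pow, AdjoinRoot.mk_X, map_one, sub_eq_zero] at this
    simpa [unitPoly, unitPolyInv] using geom_sum_unit_mul_eq_one h hr
  obtain ⟨q, hq⟩ := hdvd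
  have := congrArg (Polynomial.aeval x) hq
  simp only [map_sub, map_mul, map_one, map_pow, Polynomial.aeval_X, hx, sub_self, zero_mul] at this
  exact sub_eq_zero.1 this

/-! ### Conjugates of `E₁₁` by polynomials in the cyclic matrix -/

theorem vecMul_aeval {ι R : Type*} [Fintype ι] [DecidableEq ι] [CommRing R] {A : Matrix ι ι R}
    {w : ι → R} {z : R} (h : w ᵥ* A = z • w) (p : Polynomial ℤ) :
    w ᵥ* Polynomial.aeval A p = Polynomial.aeval z p • w := by
  induction p using Polynomial.induction_on' with
  | add p q hp hq => rw [map_add, map_add, vecMul_add, hp, hq, add_smul]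
  | monomial k c =>
    have hk : w ᵥ* A ^ k = z ^ k • w := by
      induction k with
      | zero => simp
      | succ k ih => rw [pow_succ, ← vecMul_vecMul, ih, smul_vecMul, h, smul_smul, pow_succ]
    rw [Polynomial.aeval_monomial, Polynomial.aeval_monomial, ← Algebra.smul_def,
      ← Algebra.smul_def, vecMul_smul, hk, smul_assoc]

theorem aeval_mulVec {ι R : Type*} [Fintype ι] [DecidableEq ι] [CommRing R] {A : Matrix ι ι R}
    {w : ι → R} {z : R} (h : A *ᵥ w = z • w) (p : Polynomial ℤ) :
    Polynomial.aeval A p *ᵥ w = Polynomial.aeval z p • w := by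
  induction p using Polynomial.induction_on' with
  | add p q hp hq => rw [map_add, map_add, add_mulVec, hp, hq, add_smul]
  | monomial k c =>
    have hk : A ^ k *ᵥ w = z ^ k • w := by
      induction k with
      | zero => simp
      | succ k ih => rw [pow_succ', ← mulVec_mulVec, ih, mulVec_smul, h, smul_smul, pow_succ]
    rw [Polynomial.aeval_monomial, Polynomial.aeval_monomial, ← Algebra.smul_def,
      ← Algebra.smul_def, smul_mulVec, hk, smul_assoc]

theorem conj_Y_mem {n : ℕ} [NeZero n] {P Q : Matrix (Fin n) (Fin n) ℤ} (hP : Commute (X n) P)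
    (hQ : Commute (X n) Q) (hPQ : P * Q = 1) : P * Y n * Q ∈ idempotentSet n := by
  have hQP : Q * P = 1 := mul_eq_one_comm.1 hPQ
  obtain ⟨hY, hr⟩ := single_mem (0 : Fin n)
  refine ⟨?_, ?_⟩
  · calc (P * Y n * Q) ^ 2 = P * Y n * (Q * P) * Y n * Q := by simp only [sq, mul_assoc]
      _ = P * (Y n ^ 2) * Q := by rw [hQP, mul_one, sq, mul_assoc P]
      _ = P * Y n * Q := by rw [Y, hY]
  · rw [r₂, sub_eq_zero] at hr ⊢
    calc ∑ i ∈ Finset.range n, X n ^ (n - i) * (P * Y n * Q) * X n ^ i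
        = ∑ i ∈ Finset.range n, P * (X n ^ (n - i) * Y n * X n ^ i) * Q := by
          refine Finset.sum_congr rfl fun i _ => ?_
          have e1 := (hP.pow_left (n - i)).eq
          have e2 := (hQ.pow_left i).eq
          simp only [← mul_assoc, e1]
          simp only [mul_assoc, e2]
      _ = 1 := by rw [← Finset.sum_mul, ← Finset.mul_sum, Y, hr, mul_one, hPQ]

/-! ### Size of the unit at a primitive root of unity -/

theorem sin_lt_sin_of_lt_of_add_lt {x y : ℝ} (hx : 0 ≤ x) (h : x < y) (h' : x + y < Real.pi) :
    Real.sin x < Real.sin y := by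
  rw [← sub_pos, Real.sin_sub_sin]
  have h1 : 0 < Real.sin ((y - x) / 2) :=
    Real.sin_pos_of_pos_of_lt_pi (by linarith) (by linarith)
  have h2 : 0 < Real.cos ((y + x) / 2) :=
    Real.cos_pos_of_mem_Ioo ⟨by linarith, by linarith⟩
  positivity

theorem sin_le_sin_of_le_of_add_le {x y : ℝ} (hx : 0 ≤ x) (h : x ≤ y) (h' : x + y ≤ Real.pi) :
    Real.sin x ≤ Real.sin y := by
  rw [← sub_nonneg, Real.sin_sub_sin]
  have h1 : 0 ≤ Real.sin ((y - x) / 2) :=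
    Real.sin_nonneg_of_nonneg_of_le_pi (by linarith) (by linarith)
  have h2 : 0 ≤ Real.cos ((y + x) / 2) :=
    Real.cos_nonneg_of_mem_Icc ⟨by linarith, by linarith⟩
  positivity

theorem norm_rootOfUnity_pow_sub_one {n k : ℕ} (hk : k ≤ n) :
    ‖Complex.exp (2 * Real.pi * Complex.I / n) ^ k - 1‖ = 2 * Real.sin (k * (Real.pi / n)) := by
  rcases Nat.eq_zero_or_pos n with rfl | hn
  · obtain rfl : k = 0 := by omega
    simp
  have hn' : (0 : ℝ) < n := by exact_mod_cast hn
  have e : Complex.exp (2 * Real.pi * Complex.I / n) ^ k =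
      Complex.exp (Complex.I * ((2 * (k * (Real.pi / n)) : ℝ) : ℂ)) := by
    rw [← Complex.exp_nat_mul]
    congr 1
    push_cast
    ring
  rw [e, Complex.norm_exp_I_mul_ofReal_sub_one, mul_div_cancel_left₀ _ two_ne_zero,
    Real.norm_of_nonneg]
  refine mul_nonneg zero_le_two (Real.sin_nonneg_of_nonneg_of_le_pi (by positivity) ?_)
  rw [mul_div_assoc', div_le_iff₀ hn', mul_comm]
  gcongr

/-- Take `2` for odd `n`, `n / 2 - 1` for `4 ∣ n`, and `n / 2 - 2` otherwise. -/
theorem exists_coprime {n : ℕ} (h2 : 2 ≤ n) (hn : ¬(n = 2 ∨ n = 3 ∨ n = 4 ∨ n = 6)) :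
    ∃ a, 2 ≤ a ∧ a + 2 ≤ n ∧ a.Coprime n := by
  rcases Nat.even_or_odd' n with ⟨m, rfl | rfl⟩
  · rcases Nat.even_or_odd' m with ⟨l, rfl | rfl⟩
    · refine ⟨2 * l - 1, by omega, by omega, ?_⟩
      obtain ⟨k, rfl⟩ : ∃ k, l = k + 1 := ⟨l - 1, by omega⟩
      have e : 2 * (2 * (k + 1)) = 2 + 2 * (2 * (k + 1) - 1) := by omega
      rw [e, Nat.coprime_add_mul_right_right, Nat.coprime_two_right]
      exact ⟨k, by omega⟩
    · refine ⟨2 * l + 1 - 2, by omega, by omega, ?_⟩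
      obtain ⟨k, rfl⟩ : ∃ k, l = k + 1 := ⟨l - 1, by omega⟩
      have e : 2 * (2 * (k + 1) + 1) = 2 ^ 2 + 2 * (2 * (k + 1) + 1 - 2) := by omega
      rw [e, Nat.coprime_add_mul_right_right]
      refine Nat.Coprime.pow_right _ ?_
      rw [Nat.coprime_two_right]
      exact ⟨k, by omega⟩
  · refine ⟨2, le_rfl, by omega, ?_⟩
    rw [Nat.coprime_two_left]
    exact ⟨m, rfl⟩

theorem one_lt_norm_aeval_unitPoly {n a b m : ℕ} (ha : 2 ≤ a) (han : a + 2 ≤ n) (hb : 1 ≤ b)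
    (hbn : b < n) :
    1 < ‖Polynomial.aeval (Complex.exp (2 * Real.pi * Complex.I / n)) (unitPoly n a b m)‖ := by
  have hn' : (0 : ℝ) < n := by exact_mod_cast (by omega : 0 < n)
  have h1 := norm_rootOfUnity_pow_sub_one (n := n) (k := 1) (by omega)
  have hA := norm_rootOfUnity_pow_sub_one (n := n) (k := a) (by omega)
  have hB := norm_rootOfUnity_pow_sub_one (n := n) (k := b) (by omega)
  have hroot : Complex.exp (2 * Real.pi * Complex.I / n) ^ n = 1 :=
    (Complex.isPrimitiveRoot_exp n (by omega)).pow_eq_one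
  set z := Complex.exp (2 * Real.pi * Complex.I / n)
  set θ := Real.pi / n with hθ
  have hθ0 : 0 < θ := by positivity
  have hπ : n * θ = Real.pi := by rw [hθ]; field_simp
  simp only [pow_one, Nat.cast_one, one_mul] at h1
  have hs : 0 < Real.sin θ := Real.sin_pos_of_pos_of_lt_pi hθ0 (by
    rw [← hπ]; have : (1 : ℝ) < n := by exact_mod_cast (by omega : 1 < n)
    nlinarith)
  have hsa : Real.sin θ < Real.sin (a * θ) := by
    refine sin_lt_sin_of_lt_of_add_lt hθ0.le ?_ ?_
    · have : (2 : ℝ) ≤ a := by exact_mod_cast ha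
      nlinarith
    · have : (a : ℝ) + 2 ≤ n := by exact_mod_cast han
      rw [← hπ]; nlinarith
  have hsb : Real.sin θ ≤ Real.sin (b * θ) := by
    refine sin_le_sin_of_le_of_add_le hθ0.le ?_ ?_
    · have : (1 : ℝ) ≤ b := by exact_mod_cast hb
      nlinarith
    · have : (b : ℝ) + 1 ≤ n := by exact_mod_cast hbn
      rw [← hπ]; nlinarith
  have hz1 : z - 1 ≠ 0 := by
    rw [← norm_pos_iff, h1]; positivity
  have hgeom : ∀ k : ℕ, ‖∑ i ∈ Finset.range k, z ^ i‖ * ‖z - 1‖ = ‖z ^ k - 1‖ := fun k => by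
    rw [← norm_mul, geom_sum_mul]
  have hN : ∑ i ∈ Finset.range n, z ^ i = 0 := by
    have := geom_sum_mul z n
    rw [hroot, sub_self] at this
    exact (mul_eq_zero.1 this).resolve_right hz1
  have hU : Polynomial.aeval z (unitPoly n a b m) =
      (∑ i ∈ Finset.range a, z ^ i) * ∑ i ∈ Finset.range b, z ^ i := by
    simp [unitPoly, hN]
  rw [hU, norm_mul]
  have ga := hgeom a
  have gb := hgeom b
  rw [h1, hA] at ga
  rw [h1, hB] at gb
  have la : 1 < ‖∑ i ∈ Finset.range a, z ^ i‖ := by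
    by_contra! hc
    nlinarith
  have lb : 1 ≤ ‖∑ i ∈ Finset.range b, z ^ i‖ := by
    by_contra! hc
    nlinarith
  exact one_lt_mul_of_lt_of_le la lb

/-! ### Infinitely many idempotents -/

theorem idempotentSet_infinite {n : ℕ} [NeZero n] (h2 : 2 ≤ n)
    (hn : ¬(n = 2 ∨ n = 3 ∨ n = 4 ∨ n = 6)) : (idempotentSet n).Infinite := by
  obtain ⟨a, ha, han, hcop⟩ := exists_coprime h2 hn
  obtain ⟨b, hbn, hab⟩ := Nat.exists_mul_mod_eq_one_of_coprime hcop (by omega)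
  have hb : 1 ≤ b := by
    rcases Nat.eq_zero_or_pos b with rfl | hb
    · simp at hab
    · exact hb
  obtain ⟨m, hm⟩ : ∃ m, a * b = n * m + 1 := ⟨a * b / n, by
    have := Nat.div_add_mod (a * b) n
    omega⟩
  set z := Complex.exp (2 * Real.pi * Complex.I / n)
  have hzn : z ^ n = 1 := (Complex.isPrimitiveRoot_exp n (by omega)).pow_eq_one
  set P := Polynomial.aeval (X n) (unitPoly n a b m) with hP
  set Q := Polynomial.aeval (X n) (unitPolyInv n a b m) with hQ
  have hPQ : P * Q = 1 := aeval_unitPoly_mul hm (X_pow_card n)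
  have hcomm : ∀ p, Commute (X n) (Polynomial.aeval (X n) p) := fun p => by
    have := (Commute.all (Polynomial.X : Polynomial ℤ) p).map (Polynomial.aeval (X n))
    rwa [Polynomial.aeval_X] at this
  have hPQc : Commute P Q := by
    rw [Commute, SemiconjBy, hPQ, mul_eq_one_comm.1 hPQ]
  let φ := (Int.castRingHom ℂ).mapMatrix (m := Fin n)
  -- The row vector `(ζ ^ i)` and the all-ones column are eigenvectors of `X`, for `ζ` and `1`.
  let w : Fin n → ℂ := fun i => z ^ (i : ℕ)
  have hwX : w ᵥ* φ (X n) = z • w := by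
    ext j
    have e : w (j + 1) = z * z ^ (j : ℕ) := by
      rw [← pow_succ', pow_eq_pow_mod _ hzn]
      simp only [w, Fin.val_add, Fin.val_one', Nat.add_mod_mod]
    simpa [φ, w, vecMul, dotProduct, X_apply] using e
  have hX1 : φ (X n) *ᵥ (1 : Fin n → ℂ) = (1 : ℂ) • 1 := by
    ext i
    have e : ∀ x : Fin n, i = x + 1 ↔ x = i - 1 := fun x => by
      rw [eq_sub_iff_add_eq, eq_comm]
    simp [φ, mulVec, dotProduct, X_apply, e]
  have hφ : ∀ p, Polynomial.aeval (φ (X n)) p = φ (Polynomial.aeval (X n) p) := fun p =>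
    Polynomial.aeval_algHom_apply φ.toIntAlgHom (X n) p
  have hV1 : Polynomial.aeval (1 : ℂ) (unitPolyInv n a b m) = 1 := by
    simp only [unitPolyInv, map_sub, map_mul, map_sum, map_pow, Polynomial.aeval_X, one_pow,
      Finset.sum_const, Finset.card_range, nsmul_eq_mul, mul_one, map_natCast]
    have : (a : ℂ) * b = n * m + 1 := by exact_mod_cast hm
    linear_combination this
  have hinv : ∀ k : ℕ, w ᵥ* φ (P ^ k * Y n * Q ^ k) ⬝ᵥ 1 =
      Polynomial.aeval z (unitPoly n a b m) ^ k := by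
    intro k
    have h1 := vecMul_aeval hwX (unitPoly n a b m ^ k)
    have h2 := aeval_mulVec hX1 (unitPolyInv n a b m ^ k)
    rw [hφ, map_pow, map_pow, map_pow] at h1 h2
    rw [← hP] at h1
    rw [hV1, one_pow, one_smul, ← hQ] at h2
    rw [map_mul, map_mul, map_pow, map_pow, ← vecMul_vecMul, ← vecMul_vecMul,
      ← dotProduct_mulVec, h2, h1, smul_vecMul, smul_dotProduct]
    have hY : w ᵥ* φ (Y n) ⬝ᵥ 1 = 1 := by
      have e : φ (Y n) = Matrix.single 0 0 1 := by
        ext i j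
        simp [φ, Y, Matrix.single_apply]
      rw [e]
      simp [w, vecMul, dotProduct, Matrix.single_apply, ite_and]
    rw [hY, smul_eq_mul, mul_one]
  have hχ : 1 < ‖Polynomial.aeval z (unitPoly n a b m)‖ := one_lt_norm_aeval_unitPoly ha han hb hbn
  refine Set.infinite_of_injective_forall_mem (f := fun k : ℕ => P ^ k * Y n * Q ^ k) ?_ ?_
  · intro k l hkl
    have : Polynomial.aeval z (unitPoly n a b m) ^ k =
        Polynomial.aeval z (unitPoly n a b m) ^ l := by
      rw [← hinv, ← hinv]
      exact congrArg (fun M => w ᵥ* φ M ⬝ᵥ 1) hkl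
    have := congrArg norm this
    rw [norm_pow, norm_pow] at this
    exact pow_right_injective₀ (by linarith) hχ.ne' this
  · intro k
    refine conj_Y_mem ((hcomm _).pow_right k) ((hcomm _).pow_right k) ?_
    rw [← hPQc.mul_pow, hPQ, one_pow]

end MatrixPresentation

theorem theorem3p10 (n : ℕ) [NeZero n] (hn : 2 ≤ n) :
    (∀ Y₁ ∈ MatrixPresentation.idempotentSet n,
      MatrixPresentation.SatisfiesShortPresentation n (MatrixPresentation.X n) Y₁ ∧
      Y₁.trace = 1) ∧
    ((n = 2 ∨ n = 3 ∨ n = 4 ∨ n = 6) →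
      MatrixPresentation.idempotentSet n =
        Set.range (fun i : Fin n => Matrix.single i i (1 : ℤ))) ∧
    (¬ (n = 2 ∨ n = 3 ∨ n = 4 ∨ n = 6) →
      (MatrixPresentation.idempotentSet n).Infinite ∧
      ∀ Y₁ ∈ MatrixPresentation.idempotentSet n,
        (∀ i : Fin n, Y₁ ≠ Matrix.single i i (1 : ℤ)) →
          (∃ i j, 0 < Y₁ i j) ∧ (∃ i j, Y₁ i j < 0)) ∧
    (∀ Y₁ ∈ MatrixPresentation.idempotentSet n,
      ∃ c d : Fin n → ℤ, (∀ i j, Y₁ i j = c i * d j) ∧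
        MatrixPresentation.circ c * (MatrixPresentation.circ d).transpose = 1 ∧
        (MatrixPresentation.circ d).transpose * MatrixPresentation.circ c = 1) ∧
    (∀ Y₁ ∈ MatrixPresentation.idempotentSet n,
      ∃ v : Fin n → ℤ,
        ((MatrixPresentation.circ v).det = 1 ∨ (MatrixPresentation.circ v).det = -1) ∧
        Y₁ = MatrixPresentation.circ v * MatrixPresentation.Y n *
          (MatrixPresentation.circ v)⁻¹) := by
  open MatrixPresentation in
  refine ⟨fun M hM => ⟨satisfiesShortPresentation hM, trace_eq_one ((r₂_eq_zero_iff M).1 hM.2)⟩,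
    fun h => Set.Subset.antisymm (fun M hM => ?_) ?_, fun h => ⟨idempotentSet_infinite hn h,
      fun M hM hne => ⟨?_, ?_⟩⟩, fun M hM => ?_, fun M hM => ?_⟩
  · obtain ⟨i, rfl⟩ := exists_eq_single h hM
    exact ⟨i, rfl⟩
  · rintro _ ⟨i, rfl⟩
    exact single_mem i
  · by_contra! hc
    have ht := trace_eq_one ((r₂_eq_zero_iff M).1 hM.2)
    have : M.trace ≤ 0 := Finset.sum_nonpos fun i _ => hc i i
    omega
  · by_contra! hc
    obtain ⟨i, hi⟩ := eq_single_of_nonneg ((r₂_eq_zero_iff M).1 hM.2) hc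
    exact hne i hi
  · obtain ⟨c, d, hcd, h⟩ := exists_factorization hM
    have h1 : circ c * (circ d)ᵀ = 1 := by
      ext a b
      simp only [Matrix.mul_apply, Matrix.transpose_apply, circ_apply, Matrix.one_apply]
      simpa [sub_eq_neg_add] using h (-a) (-b)
    exact ⟨c, d, hcd, h1, mul_eq_one_comm.1 h1⟩
  · obtain ⟨c, d, hcd, h⟩ := exists_factorization hM
    -- `circ v` has first column `v (-a)`, so the index is negated to get `c` as the first column.
    have h1 : circ (fun i => c (-i)) * (circ (fun i => d (-i)))ᵀ = 1 := by
      ext a b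
      simp only [Matrix.mul_apply, Matrix.transpose_apply, circ_apply, Matrix.one_apply, neg_sub]
      rw [← h a b, ← Equiv.sum_comp (Equiv.neg (Fin n))]
      simp
    refine ⟨fun i => c (-i), ?_, ?_⟩
    · exact Int.isUnit_iff.1 ((Matrix.isUnit_iff_isUnit_det _).1 (IsUnit.of_mul_eq_one _ h1))
    · rw [Matrix.inv_eq_right_inv h1]
      ext a b
      rw [hcd, Y, Matrix.mul_apply, Finset.sum_eq_single 0]
      · simp [circ_apply, Matrix.mul_apply, Matrix.single_apply]
      · intro t _ ht
        simp [Matrix.mul_apply, ht.symm]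
      · simp
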